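/- **Conventions.** Let $n\in\{1,2,\dots\}\cup\{\infty\}$. An *open domain* is an open subset $H$ of some $\mathbb R^u$, $u\in\mathbb N$. *$\mathcal C^n$ spaces.* A $\mathcal C^n$ space $X$ is a set $|X|$ together with, for each open domain $H$, a set of maps $H\to|X|$ (the *figures* of type $H$), such that: figures are closed under precomposition with $\mathcal C^n$ maps of open domains; constant maps are figures; a map $H\to |X|$ whose restrictions to the members of some open cover of $H$ are figures is a figure. An arrow $X\to Y$ is a map $|X|\to|Y|$ taking figures to figures by composition. For $A\subseteq|X|$, $(A\prec X)$ has as figures the maps into $A$ that are figures of $X$. A set $U\subseteq |X|$ is open if $d^{-1}(U)$ is open for every figure $d$. A finite-dimensional normed space $E$ (in particular $\mathbb R^k$), or an open domain, is a $\mathcal C^n$ space with the ordinary $\mathcal C^n$ maps as figures. A *zone* $UK$ of $X$ is an open $U\subseteq|X|$ with an open domain $K$; an *observable* on $UK$ is an arrow $\varphi:(U\prec X)\to K$. *Extension.* A *nilpotent path* of $X$ is a map $x:\mathbb R\to|X|$, continuous at $0$, such that for every observable $\varphi$ on a zone $UK$ with $x_0\in U$ there is $k\in\mathbb N$ with $\|\varphi(x_t)-\varphi(x_0)\|^k=o(t)$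 as $t\to0$. Two nilpotent paths satisfy $x\sim y$ if for every observable $\varphi$ on a zone $UK$: $x_0\in U\iff y_0\in U$, and $x_0\in U$ implies $\varphi(x_t)=\varphi(y_t)+o(t)$. The set of classes is ${}^\bullet X$; an arrow $f$ induces ${}^\bullet f([x])=[f\circ x]$. Standard points are identified with classes of constant paths. For $U$ open in $X$, ${}^\bullet U:={}^\bullet(U\prec X)$ is regarded as a subset of ${}^\bullet X$ through the (injective) extension of the inclusion. In ${}^\bullet\mathbb R$ and ${}^\bullet\mathbb R^k$, sums and products by scalars in ${}^\bullet\mathbb R$ are computed on representatives. Put $D:=\{[h]\in{}^\bullet\mathbb R : h(t)=O(t)\text{ as }t\to0\}$. *Extended spaces.* Types of figures are now the subsets $T\subseteq{}^\bullet\mathbb R^{t}$, $t\in\mathbb N$, with the topology generated by the sets ${}^\bullet U\cap T$, $U\subseteq\mathbb R^t$ open. An arrow of types $f:S\to T$ (with $S\subseteq{}^\bullet\mathbb R^s$) is a map such that for every $s_0\in S$ there are an extended parameter $p\in{}^\bullet\mathbb R^m$ for some $m$, open sets $U\subseteq\mathbb R^m$, $V\subseteq\mathbb R^s$ with $p\in{}^\bullet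 U$, $s_0\in{}^\bullet V$, and a $\mathcal C^n$ map $g:U\times V\to\mathbb R^t$, with $f(x)={}^\bullet g\langle p,x\rangle$ for all $x\in{}^\bullet V\cap S$, where $\langle[p],[x]\rangle=[(p,x)]$. For $Z\subseteq{}^\bullet X$, the extended space ${}^\bullet(ZX)$ has support $Z$, and its figures $\delta:S\to Z$ are the maps that on a neighbourhood of every point of $S$ (open in $S$) are a composition $d\circ f$ of an arrow of types $f$ with a map $d:T\to Z$ that is constant or equal to ${}^\bullet h|_T$ for some figure $h:V\to|X|$ of $X$ with $T\subseteq{}^\bullet V$. The sets $D$ and ${}^\bullet X$ are considered as the extended spaces ${}^\bullet(D\,\mathbb R)$ and ${}^\bullet({}^\bullet X\,X)$. An arrow of extended spaces is a map taking figures to figures of the same type by composition. **Theorem.** Let $X$ be a $\mathcal C^n$ space, $\varphi$ an observable on a zone $U\,\mathbb R^k$ of $X$, and $f:D\to{}^\bullet X$ an arrow of extended spaces with $f(0)\in{}^\bullet U$. Then $f(h)\in{}^\bullet U$ for all $h\in D$, and there is one and only one pair $a\in{}^\bullet\mathbb R^k$, $b\in\mathbb R^k$ such that $${}^\bullet\varphi(f(h))=a+h\cdot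 b\qquad\text{for all }h\in D.$$ -/

import Mathlib

open Filter Topology Asymptotics

/-- The Euclidean space of dimension `k`. -/
abbrev Euc (k : ℕ) : Type := EuclideanSpace ℝ (Fin k)

/-- A function on a subset `A`, extended by `0`; only used at points of `A`, or at points near a
given point of an open `A`, where the value outside `A` is irrelevant. -/
noncomputable def zeroExt {S E : Type*} [Zero E] {A : Set S} (f : A → E) : S → E :=
  Function.extend Subtype.val f (fun _ => 0)

theorem zeroExt_of_mem {S E : Type*} [Zero E] {A : Set S} (f : A → E) {x : S} (hx : x ∈ A) :
    zeroExt f x = f ⟨x, hx⟩ :=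
  Subtype.val_injective.extend_apply f (fun _ => 0) ⟨x, hx⟩

/-! ### Open domains and `Cⁿ` maps between them -/

/-- The objects of the category of figure types: open subsets of some `ℝᵘ`, `u ∈ ℕ`. -/
structure OpenDomain where
  dim : ℕ
  carrier : Set (Euc dim)
  isOpen : IsOpen carrier

instance : CoeSort OpenDomain Type := ⟨fun H => H.carrier⟩

/-- `f : H → E` is an ordinary `Cⁿ` map on the open set `H`. -/
def IsCn (n : ℕ∞) {E : Type*} [NormedAddCommGroup E] [NormedSpace ℝ E] (H : OpenDomain)
    (f : H → E) : Prop :=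
  ContDiffOn ℝ n (zeroExt f) H.carrier

/-- `f : J → H` is an ordinary `Cⁿ` map between open sets. -/
def OpenDomain.Hom (n : ℕ∞) (J H : OpenDomain) (f : J → H) : Prop :=
  IsCn n J (fun x => (f x : Euc H.dim))

/-- The restriction of `H` to an open subset `V ⊆ H`. -/
def OpenDomain.restrict (H : OpenDomain) (V : Set (Euc H.dim)) (hV : IsOpen V) : OpenDomain :=
  ⟨H.dim, V, hV⟩

theorem IsCn.comp {n : ℕ∞} {E : Type*} [NormedAddCommGroup E] [NormedSpace ℝ E]
    {J H : OpenDomain} {f : J → H} {d : H → E} (hd : IsCn n H d) (hf : J.Hom n H f) :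
    IsCn n J (d ∘ f) := by
  have h := ContDiffOn.comp (s := J.carrier) hd hf (fun x hx => by
    rw [zeroExt_of_mem _ hx]; exact (f ⟨x, hx⟩).2)
  refine h.congr fun x hx => ?_
  rw [zeroExt_of_mem _ hx, Function.comp_apply, Function.comp_apply, zeroExt_of_mem _ hx,
    zeroExt_of_mem _ (f ⟨x, hx⟩).2]

theorem IsCn.const {n : ℕ∞} {E : Type*} [NormedAddCommGroup E] [NormedSpace ℝ E]
    (H : OpenDomain) (e : E) : IsCn n H (fun _ => e) :=
  (contDiffOn_const (c := e)).congr fun _ hx => zeroExt_of_mem _ hx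

theorem IsCn.sheaf {n : ℕ∞} {E : Type*} [NormedAddCommGroup E] [NormedSpace ℝ E]
    {H : OpenDomain} {d : H → E}
    (h : ∀ x : H, ∃ (V : Set (Euc H.dim)) (hV : IsOpen V) (hVH : V ⊆ H.carrier),
      (x : Euc H.dim) ∈ V ∧ IsCn n (H.restrict V hV) (fun v => d ⟨v.1, hVH v.2⟩)) :
    IsCn n H d := by
  intro x hx
  obtain ⟨V, hV, hVH, hxV, hd⟩ := h ⟨x, hx⟩
  have h1 : ContDiffOn ℝ n (zeroExt d) V := ContDiffOn.congr hd fun y hy => by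
    rw [zeroExt_of_mem _ (hVH hy)]
    exact (zeroExt_of_mem (A := V) (fun v => d ⟨v.1, hVH v.2⟩) hy).symm
  exact (h1.contDiffAt (hV.mem_nhds hxV)).contDiffWithinAt

theorem IsCn.continuous {n : ℕ∞} {E : Type*} [NormedAddCommGroup E] [NormedSpace ℝ E]
    {H : OpenDomain} {d : H → E} (hd : IsCn n H d) : Continuous d := by
  have h := (ContDiffOn.continuousOn hd).domRestrict
  convert h using 1
  funext x
  exact (zeroExt_of_mem d x.2).symm

/-! ### `Cⁿ` spaces -/

/-- A `Cⁿ` space with support set `S`: a family of figures `d : H → S`, for `H` an open domain,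
closed under `Cⁿ` reparametrization, containing the constant maps, and of local character. -/
structure CnSpace (n : ℕ∞) (S : Type*) where
  fig : ∀ H : OpenDomain, Set (H → S)
  comp_mem : ∀ {J H : OpenDomain} {f : J → H} {d : H → S},
    J.Hom n H f → d ∈ fig H → d ∘ f ∈ fig J
  const_mem : ∀ (H : OpenDomain) (s : S), (fun _ => s) ∈ fig H
  sheaf : ∀ {H : OpenDomain} {d : H → S},
    (∀ x : H, ∃ (V : Set (Euc H.dim)) (hV : IsOpen V) (hVH : V ⊆ H.carrier),
      (x : Euc H.dim) ∈ V ∧ (fun v => d ⟨v.1, hVH v.2⟩) ∈ fig (H.restrict V hV)) → d ∈ fig H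

namespace CnSpace

variable {n : ℕ∞} {S S' : Type*}

/-- `f` is an arrow of `Cⁿ` spaces: it takes figures to figures of the same type. -/
def IsArrow (X : CnSpace n S) (Y : CnSpace n S') (f : S → S') : Prop :=
  ∀ (H : OpenDomain), ∀ d ∈ X.fig H, f ∘ d ∈ Y.fig H

/-- The subspace `(A ≺ X)` induced by `X` on the subset `A`. -/
def sub (X : CnSpace n S) (A : Set S) : CnSpace n A where
  fig H := {d | (fun h => (d h : S)) ∈ X.fig H}
  comp_mem hf hd := X.comp_mem hf hd
  const_mem H s := X.const_mem H s
  sheaf h := X.sheaf h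

/-- The final topology with respect to all the figures. -/
@[reducible]
def topology (X : CnSpace n S) : TopologicalSpace S where
  IsOpen U := ∀ (H : OpenDomain), ∀ d ∈ X.fig H, IsOpen (d ⁻¹' U)
  isOpen_univ _ _ _ := isOpen_univ
  isOpen_inter _ _ hU hV H d hd := (hU H d hd).inter (hV H d hd)
  isOpen_sUnion _ h H d hd := by
    rw [Set.preimage_sUnion]
    exact isOpen_biUnion fun U hU => h U hU H d hd

/-- The `Cⁿ` space of a normed space `E`: its figures are the ordinary `Cⁿ` maps into `E`. -/
def std (n : ℕ∞) (E : Type*) [NormedAddCommGroup E] [NormedSpace ℝ E] : CnSpace n E where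
  fig H := {d | IsCn n H d}
  comp_mem hf hd := hd.comp hf
  const_mem H s := IsCn.const H s
  sheaf h := IsCn.sheaf h

/-- The `Cⁿ` space of an open domain `K`: its figures are the ordinary `Cⁿ` maps into `K`. -/
noncomputable def bar (n : ℕ∞) (K : OpenDomain) : CnSpace n K := (std n (Euc K.dim)).sub K.carrier

/-- `c` is an observable on the zone `UK` of `X`: `U` is open in `X`, `K` is an open domain and
`c : (U ≺ X) → K` is an arrow. -/
def IsObservable (X : CnSpace n S) (U : Set S) (K : OpenDomain) (c : U → K) : Prop :=
  IsOpen[X.topology] U ∧ (X.sub U).IsArrow (bar n K) c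

/-- The values of an observable, as vectors. -/
noncomputable def obs {U : Set S} {K : OpenDomain} (c : U → K) : S → Euc K.dim :=
  zeroExt fun u => (c u : Euc K.dim)

/-! ### Nilpotent paths and the extension of a `Cⁿ` space -/

/-- `x : ℝ → S` is continuous at the origin and nilpotent relative to `X`. -/
def IsNilpotentPath (X : CnSpace n S) (x : ℝ → S) : Prop :=
  @ContinuousAt ℝ S _ X.topology x 0 ∧
  ∀ (U : Set S) (K : OpenDomain) (c : U → K), X.IsObservable U K c → x 0 ∈ U →
    ∃ k : ℕ, (fun t => ‖obs c (x t) - obs c (x 0)‖ ^ k) =o[𝓝 0] (fun t : ℝ => t)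

/-- The relation `x ∼ y in X`. -/
def PathEquiv (X : CnSpace n S) (x y : ℝ → S) : Prop :=
  ∀ (U : Set S) (K : OpenDomain) (c : U → K), X.IsObservable U K c →
    (x 0 ∈ U ↔ y 0 ∈ U) ∧
    (x 0 ∈ U → (fun t => obs c (x t) - obs c (y t)) =o[𝓝 0] (fun t : ℝ => t))

/-- The set of nilpotent paths of `X`. -/
def NilpotentPath (X : CnSpace n S) : Type _ := {x : ℝ → S // X.IsNilpotentPath x}

instance pathSetoid (X : CnSpace n S) : Setoid X.NilpotentPath where
  r x y := X.PathEquiv x.1 y.1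
  iseqv :=
    { refl := fun x U K c _ => ⟨Iff.rfl, fun _ => by simp⟩
      symm := fun {x y} h U K c hc => ⟨(h U K c hc).1.symm, fun hy => by
        simpa using ((h U K c hc).2 ((h U K c hc).1.2 hy)).neg_left⟩
      trans := fun {x y z} h h' U K c hc =>
        ⟨(h U K c hc).1.trans (h' U K c hc).1, fun hx => by
          simpa using ((h U K c hc).2 hx).add ((h' U K c hc).2 ((h U K c hc).1.1 hx))⟩ }

/-- The (support set of the) extension of a `Cⁿ` space by infinitesimal points. -/
def Ext (X : CnSpace n S) : Type _ := Quotient X.pathSetoid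

/-- The extended point represented by a nilpotent path. -/
def Ext.mk (X : CnSpace n S) (x : ℝ → S) (hx : X.IsNilpotentPath x) : X.Ext :=
  Quotient.mk X.pathSetoid ⟨x, hx⟩

theorem Ext.mk_eq_mk {X : CnSpace n S} {x y : ℝ → S} {hx : X.IsNilpotentPath x}
    {hy : X.IsNilpotentPath y} : Ext.mk X x hx = Ext.mk X y hy ↔ X.PathEquiv x y :=
  Quotient.eq (r := X.pathSetoid)

theorem isNilpotentPath_const (X : CnSpace n S) (s : S) : X.IsNilpotentPath (fun _ => s) :=
  ⟨@continuousAt_const ℝ S _ X.topology 0 s, fun _ _ _ _ _ => ⟨1, by simp⟩⟩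

/-- The standard points, as classes of constant paths. -/
def Ext.const (X : CnSpace n S) (s : S) : X.Ext := Ext.mk X (fun _ => s) (X.isNilpotentPath_const s)

theorem IsArrow.continuous {X : CnSpace n S} {Y : CnSpace n S'} {f : S → S'}
    (hf : X.IsArrow Y f) : @Continuous S S' X.topology Y.topology f :=
  @Continuous.mk S S' X.topology Y.topology f fun _ hU H d hd => hU H (f ∘ d) (hf H d hd)

/-- Arrows pull observables back to observables. -/
theorem IsArrow.isObservable {X : CnSpace n S} {Y : CnSpace n S'} {f : S → S'}
    (hf : X.IsArrow Y f) {U : Set S'} {K : OpenDomain} {c : U → K} (hc : Y.IsObservable U K c) :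
    X.IsObservable (f ⁻¹' U) K (fun u => c ⟨f u.1, u.2⟩) :=
  ⟨fun H d hd => hc.1 H (f ∘ d) (hf H d hd),
    fun H d hd => hc.2 H (fun h => ⟨f (d h).1, (d h).2⟩) (hf H _ hd)⟩

theorem obs_preimage {f : S → S'} {U : Set S'} {K : OpenDomain} (c : U → K) (s : S) :
    obs (fun u : f ⁻¹' U => c ⟨f u.1, u.2⟩) s = obs c (f s) := by
  by_cases h : f s ∈ U
  · unfold obs
    rw [zeroExt_of_mem _ h, zeroExt_of_mem _ (show s ∈ f ⁻¹' U from h)]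
  · unfold obs zeroExt
    rw [Function.extend_apply', Function.extend_apply']
    · rintro ⟨a, ha⟩; exact h (ha ▸ a.2)
    · rintro ⟨a, ha⟩; exact h (show f s ∈ U from ha ▸ a.2)

theorem IsArrow.isNilpotentPath {X : CnSpace n S} {Y : CnSpace n S'} {f : S → S'}
    (hf : X.IsArrow Y f) {x : ℝ → S} (hx : X.IsNilpotentPath x) :
    Y.IsNilpotentPath (f ∘ x) := by
  refine ⟨?_, fun U K c hc h0 => ?_⟩
  · let := X.topology
    let := Y.topology
    exact (hf.continuous.continuousAt).comp hx.1
  · obtain ⟨k, hk⟩ := hx.2 _ K _ (hf.isObservable hc) h0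
    exact ⟨k, by simpa only [obs_preimage, Function.comp_apply] using hk⟩

theorem IsArrow.pathEquiv {X : CnSpace n S} {Y : CnSpace n S'} {f : S → S'}
    (hf : X.IsArrow Y f) {x y : ℝ → S} (h : X.PathEquiv x y) :
    Y.PathEquiv (f ∘ x) (f ∘ y) := by
  intro U K c hc
  have := h _ K _ (hf.isObservable hc)
  simpa only [obs_preimage, Function.comp_apply, Set.mem_preimage] using this

/-- The extension of an arrow: composition with representatives. -/
def Ext.map {X : CnSpace n S} {Y : CnSpace n S'} (f : S → S') (hf : X.IsArrow Y f) :
    X.Ext → Y.Ext :=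
  Quotient.map' (s₁ := X.pathSetoid) (s₂ := Y.pathSetoid)
    (fun x => ⟨f ∘ x.1, hf.isNilpotentPath x.2⟩) fun _ _ h => hf.pathEquiv h

theorem isArrow_val (X : CnSpace n S) (A : Set S) : (X.sub A).IsArrow X Subtype.val :=
  fun _ _ hd => hd

/-- The extension of `(A ≺ X)`, as a subset of the extension of `X` via the extended inclusion. -/
def dot (X : CnSpace n S) (A : Set S) : Set X.Ext :=
  Set.range (Ext.map Subtype.val (X.isArrow_val A))

/-- Open subsets of an open subspace are open in the space. -/
theorem isOpen_image_val {X : CnSpace n S} {A : Set S} (hA : IsOpen[X.topology] A) {W : Set A}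
    (hW : IsOpen[(X.sub A).topology] W) : IsOpen[X.topology] (Subtype.val '' W) := by
  intro H d hd
  have hV : IsOpen (Subtype.val '' (d ⁻¹' A) : Set (Euc H.dim)) :=
    H.isOpen.isOpenMap_subtype_val _ (hA H d hd)
  have hsub : (Subtype.val '' (d ⁻¹' A) : Set (Euc H.dim)) ⊆ H.carrier := by
    rintro _ ⟨y, -, rfl⟩; exact y.2
  let J := H.restrict _ hV
  let i : J → H := fun v => ⟨v.1, hsub v.2⟩
  have hi : J.Hom n H i := (contDiffOn_id (n := n)).congr fun x hx => zeroExt_of_mem _ hx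
  have hmem : ∀ v : J, d (i v) ∈ A := by
    rintro ⟨_, y, hy, rfl⟩; exact hy
  have ho := hW J (fun v => ⟨d (i v), hmem v⟩) (X.comp_mem hi hd)
  have hio : IsOpenMap i := fun O hO => by
    have h1 := hV.isOpenMap_subtype_val _ hO
    have h2 := h1.preimage (continuous_subtype_val (p := fun x => x ∈ H.carrier))
    convert h2 using 1
    ext y
    constructor
    · rintro ⟨v, hv, rfl⟩; exact ⟨v, hv, rfl⟩
    · rintro ⟨v, hv, hvy⟩; exact ⟨v, hv, Subtype.ext hvy⟩
  convert hio _ ho using 1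
  ext y
  constructor
  · rintro ⟨w, hw, hwy⟩
    have hy : d y ∈ A := hwy ▸ w.2
    refine ⟨⟨y.1, y, hy, rfl⟩, ?_, rfl⟩
    have : w = ⟨d y, hy⟩ := Subtype.ext hwy
    subst this; exact hw
  · rintro ⟨v, hv, rfl⟩
    exact ⟨_, hv, rfl⟩

/-- The extension of an open subspace is a subset of the extension of the space. -/
theorem Ext.map_val_injective {X : CnSpace n S} {A : Set S} (hA : IsOpen[X.topology] A) :
    Function.Injective (Ext.map Subtype.val (X.isArrow_val A)) := by
  rintro ⟨x, hx⟩ ⟨y, hy⟩ h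
  refine Ext.mk_eq_mk.2 fun W K c hc => ?_
  have h' : X.PathEquiv (Subtype.val ∘ x) (Subtype.val ∘ y) := Ext.mk_eq_mk.1 h
  let g : (Subtype.val '' W : Set S) → W := fun s => ⟨⟨s.1, by
    obtain ⟨w, -, hw⟩ := s.2; exact hw ▸ w.2⟩, by
    obtain ⟨w, hw, hws⟩ := s.2
    have e : (⟨s.1, hws ▸ w.2⟩ : A) = w := Subtype.ext hws.symm
    rw [e]; exact hw⟩
  have key := h' (Subtype.val '' W) K (fun s => c (g s))
    ⟨isOpen_image_val hA hc.1, fun H d hd => hc.2 H (fun v => g (d v)) hd⟩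
  have hm : ∀ a : A, (a : S) ∈ (Subtype.val '' W : Set S) ↔ a ∈ W := fun a =>
    Subtype.val_injective.mem_set_image
  have ho : ∀ a : A, obs (fun s => c (g s)) (a : S) = obs c a := fun a => by
    by_cases ha : a ∈ W
    · unfold obs
      rw [zeroExt_of_mem _ ha, zeroExt_of_mem _ ((hm a).2 ha)]
    · unfold obs zeroExt
      rw [Function.extend_apply', Function.extend_apply']
      · rintro ⟨b, hb⟩; exact ha (hb ▸ b.2)
      · rintro ⟨b, hb⟩; exact ha ((hm a).1 (hb ▸ b.2))
  simpa only [Function.comp_apply, hm, ho] using key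

/-- The value of the extension of `f : (A ≺ X) → Y` at a point of the extension of `(A ≺ X)`, the
latter seen as a subset of the extension of `X`. -/
noncomputable def Ext.mapOn {X : CnSpace n S} {Y : CnSpace n S'} {A : Set S} (f : A → S')
    (hf : (X.sub A).IsArrow Y f) (z : X.dot A) : Y.Ext :=
  Ext.map f hf z.2.choose

theorem Ext.mapOn_map {X : CnSpace n S} {Y : CnSpace n S'} {A : Set S}
    (hA : IsOpen[X.topology] A) (f : A → S') (hf : (X.sub A).IsArrow Y f) (u : (X.sub A).Ext) :
    Ext.mapOn f hf ⟨Ext.map Subtype.val (X.isArrow_val A) u, u, rfl⟩ = Ext.map f hf u := by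
  unfold Ext.mapOn
  congr 1
  exact Ext.map_val_injective hA (Exists.choose_spec (p := fun v =>
    Ext.map Subtype.val (X.isArrow_val A) v = Ext.map Subtype.val (X.isArrow_val A) u) ⟨u, rfl⟩)

/-! ### The extended real field `·ℝ` and the `·ℝ`-module `·ℝᵏ` -/

section Std

variable {E F : Type*} [NormedAddCommGroup E]

theorem tendsto_of_isLittleO {x : ℝ → E} {k : ℕ}
    (h : (fun t => ‖x t - x 0‖ ^ k) =o[𝓝 0] (fun t : ℝ => t)) :
    Tendsto x (𝓝 0) (𝓝 (x 0)) := by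
  have h0 : Tendsto (fun t => ‖x t - x 0‖ ^ k) (𝓝 0) (𝓝 0) := h.trans_tendsto tendsto_id
  have hk : k ≠ 0 := by
    rintro rfl
    simp at h0
  rw [tendsto_iff_norm_sub_tendsto_zero]
  refine tendsto_order.2 ⟨fun a ha => Eventually.of_forall fun t => ha.trans_le (norm_nonneg _),
    fun a ha => ?_⟩
  filter_upwards [h0.eventually (gt_mem_nhds (pow_pos ha k))] with t ht
  exact lt_of_pow_lt_pow_left₀ k ha.le ht

variable [NormedSpace ℝ E] [NormedAddCommGroup F] [NormedSpace ℝ F]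

/-- A `Cⁿ` map on a subset of `E` is an arrow. -/
theorem isArrow_of_contDiffOn {A : Set E} {g : A → F} (hg : ContDiffOn ℝ n (zeroExt g) A) :
    ((std n E).sub A).IsArrow (std n F) g := by
  intro H d hd
  have h := ContDiffOn.comp (s := H.carrier) hg hd (fun x hx => by
    rw [zeroExt_of_mem _ hx]; exact (d ⟨x, hx⟩).2)
  refine h.congr fun x hx => ?_
  rw [zeroExt_of_mem _ hx, Function.comp_apply, Function.comp_apply, zeroExt_of_mem _ hx,
    zeroExt_of_mem _ (d ⟨x, hx⟩).2]

theorem isArrow_of_contDiff {g : E → F} (hg : ContDiff ℝ n g) :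
    (std n E).IsArrow (std n F) g := by
  intro H d hd
  refine (hg.comp_contDiffOn hd).congr fun x hx => ?_
  rw [zeroExt_of_mem _ hx]
  exact congrArg g (zeroExt_of_mem d hx).symm

variable [FiniteDimensional ℝ E] [FiniteDimensional ℝ F]

/-- The chart of the open set `U` of `E` given by linear coordinates. -/
noncomputable abbrev chartDomain (U : Set E) (hU : IsOpen U) : OpenDomain :=
  ⟨Module.finrank ℝ E, (toEuclidean (E := E)).symm ⁻¹' U,
    hU.preimage (toEuclidean (E := E)).symm.continuous⟩

theorem chart_mem_fig (U : Set E) (hU : IsOpen U) :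
    (fun v : chartDomain U hU => (toEuclidean (E := E)).symm v.1) ∈ (std n E).fig _ :=
  ((toEuclidean (E := E)).symm.contDiff.contDiffOn).congr fun _ hx => zeroExt_of_mem _ hx

theorem isOpen_std {U : Set E} : IsOpen[(std n E).topology] U ↔ IsOpen U := by
  constructor
  · intro h
    have h1 := h _ _ (chart_mem_fig (n := n) Set.univ isOpen_univ)
    have h2 := (chartDomain (Set.univ : Set E) isOpen_univ).isOpen.isOpenMap_subtype_val _ h1
    convert h2.preimage (toEuclidean (E := E)).continuous using 1
    ext x
    constructor
    · intro hx
      exact ⟨⟨toEuclidean x, trivial⟩,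
        show (toEuclidean (E := E)).symm (toEuclidean x) ∈ U by simpa using hx, rfl⟩
    · rintro ⟨v, hv, hvx⟩
      have h3 : (toEuclidean (E := E)).symm v.1 ∈ U := hv
      rwa [hvx, ContinuousLinearEquiv.symm_apply_apply] at h3
  · intro h H d hd
    exact h.preimage (IsCn.continuous hd)

theorem topology_std : (std n E).topology = (inferInstance : TopologicalSpace E) :=
  TopologicalSpace.ext_iff.2 fun _ => isOpen_std

/-- Observables on `E` are ordinary `Cⁿ` maps. -/
theorem IsObservable.contDiffOn {U : Set E} {K : OpenDomain} {c : U → K}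
    (hc : (std n E).IsObservable U K c) : ContDiffOn ℝ n (obs c) U := by
  have hU := isOpen_std.1 hc.1
  have h := hc.2 (chartDomain U hU) (fun v => ⟨(toEuclidean (E := E)).symm v.1, v.2⟩)
    (chart_mem_fig U hU)
  have h' := ContDiffOn.comp (s := U) h (toEuclidean (E := E)).contDiff.contDiffOn
    (fun x hx => show (toEuclidean (E := E)).symm (toEuclidean x) ∈ U by simpa using hx)
  refine h'.congr fun x hx => ?_
  have hx' : (toEuclidean (E := E)).symm (toEuclidean x) ∈ U := by simpa using hx
  have e1 : obs c x = c ⟨x, hx⟩ := zeroExt_of_mem _ hx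
  have e2 := zeroExt_of_mem (fun v : chartDomain U hU =>
    (c ⟨(toEuclidean (E := E)).symm v.1, v.2⟩ : Euc K.dim)) (x := toEuclidean x) hx'
  refine e1.trans (Eq.trans ?_ e2.symm)
  simp

theorem isObservable_chart :
    (std n E).IsObservable Set.univ (chartDomain (Set.univ : Set E) isOpen_univ)
      (fun u => ⟨toEuclidean u.1, trivial⟩) := by
  refine ⟨isOpen_std.2 isOpen_univ, fun H d hd => ?_⟩
  refine ((toEuclidean (E := E)).contDiff.comp_contDiffOn (s := H.carrier) hd).congr
    fun x hx => ?_
  refine (zeroExt_of_mem _ hx).trans ?_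
  exact congrArg (toEuclidean (E := E)) (zeroExt_of_mem (fun h => (d h : E)) hx).symm

theorem obs_chart (x : E) :
    obs (K := chartDomain (Set.univ : Set E) isOpen_univ)
      (fun u : (Set.univ : Set E) => ⟨toEuclidean u.1, trivial⟩) x = toEuclidean x :=
  zeroExt_of_mem _ (Set.mem_univ x)

theorem norm_isBigO_chart (u v : ℝ → E) :
    (fun t => u t - v t) =O[𝓝 0] (fun t => toEuclidean (u t) - toEuclidean (v t)) := by
  have := ((toEuclidean (E := E)).symm : _ →L[ℝ] E).isBigO_comp
    (fun t => toEuclidean (u t) - toEuclidean (v t)) (𝓝 (0 : ℝ))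
  simpa using this

theorem IsObservable.isBigO [hn : Fact (1 ≤ n)] {U : Set E} {K : OpenDomain} {c : U → K}
    (hc : (std n E).IsObservable U K c) {u v : ℝ → E} {e : E} (he : e ∈ U)
    (hu : Tendsto u (𝓝 0) (𝓝 e)) (hv : Tendsto v (𝓝 0) (𝓝 e)) :
    (fun t => obs c (u t) - obs c (v t)) =O[𝓝 0] (fun t => u t - v t) := by
  have h1 : ContDiffAt ℝ 1 (obs c) e :=
    (hc.contDiffOn.contDiffAt ((isOpen_std.1 hc.1).mem_nhds he)).of_le (by exact_mod_cast hn.out)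
  obtain ⟨C, s, hs, hC⟩ := h1.exists_lipschitzOnWith
  refine IsBigO.of_bound C ?_
  filter_upwards [hu hs, hv hs] with t hut hvt
  simpa [dist_eq_norm] using hC.dist_le_mul _ hut _ hvt

/-- Nilpotency in a normed space is nilpotency in the elementary sense. -/
theorem isNilpotentPath_std [Fact (1 ≤ n)] {x : ℝ → E} :
    (std n E).IsNilpotentPath x ↔
      ∃ k : ℕ, (fun t => ‖x t - x 0‖ ^ k) =o[𝓝 0] (fun t : ℝ => t) := by
  constructor
  · intro h
    obtain ⟨k, hk⟩ := h.2 _ _ _ isObservable_chart (Set.mem_univ _)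
    refine ⟨k, IsBigO.trans_isLittleO ?_ hk⟩
    simp only [obs_chart]
    exact ((norm_isBigO_chart x fun _ => x 0).norm_norm).pow k
  · rintro ⟨k, hk⟩
    have hx := tendsto_of_isLittleO hk
    refine ⟨by rw [topology_std]; exact hx, fun U K c hc h0 => ⟨k, IsBigO.trans_isLittleO ?_ hk⟩⟩
    exact ((hc.isBigO h0 hx tendsto_const_nhds).norm_norm).pow k

theorem IsNilpotentPath.tendsto {x : ℝ → E} (hx : (std n E).IsNilpotentPath x) :
    Tendsto x (𝓝 0) (𝓝 (x 0)) := by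
  have := hx.1
  rw [topology_std] at this
  exact this

/-- In a normed space `x ∼ y` means `x(t) = y(t) + o(t)`. -/
theorem pathEquiv_std [Fact (1 ≤ n)] {x y : ℝ → E} (hx : (std n E).IsNilpotentPath x)
    (hy : (std n E).IsNilpotentPath y) :
    (std n E).PathEquiv x y ↔ (fun t => x t - y t) =o[𝓝 0] (fun t : ℝ => t) := by
  constructor
  · intro h
    have := (h _ _ _ isObservable_chart).2 (Set.mem_univ _)
    simp only [obs_chart] at this
    exact (norm_isBigO_chart x y).trans_isLittleO this
  · intro h U K c hc
    have h0 : x 0 = y 0 := by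
      have h1 : Tendsto (fun t => x t - y t) (𝓝 0) (𝓝 0) := h.trans_tendsto tendsto_id
      exact sub_eq_zero.1 (tendsto_nhds_unique (hx.tendsto.sub hy.tendsto) h1)
    exact ⟨by rw [h0], fun hU => (hc.isBigO hU hx.tendsto (h0 ▸ hy.tendsto)).trans_isLittleO h⟩

theorem isNilpotentPath_pair [Fact (1 ≤ n)] {x : ℝ → E} {y : ℝ → F}
    (hx : (std n E).IsNilpotentPath x) (hy : (std n F).IsNilpotentPath y) :
    (std n (E × F)).IsNilpotentPath (fun t => (x t, y t)) := by
  obtain ⟨k, hk⟩ := isNilpotentPath_std.1 hx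
  obtain ⟨l, hl⟩ := isNilpotentPath_std.1 hy
  refine isNilpotentPath_std.2 ⟨k + l, ?_⟩
  have hx0 : Tendsto (fun t => ‖x t - x 0‖) (𝓝 0) (𝓝 0) :=
    tendsto_iff_norm_sub_tendsto_zero.1 hx.tendsto
  have hy0 : Tendsto (fun t => ‖y t - y 0‖) (𝓝 0) (𝓝 0) :=
    tendsto_iff_norm_sub_tendsto_zero.1 hy.tendsto
  refine IsBigO.trans_isLittleO (IsBigO.of_bound 1 ?_) (hk.norm_left.add hl.norm_left)
  filter_upwards [hx0.eventually (ge_mem_nhds one_pos), hy0.eventually (ge_mem_nhds one_pos)]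
    with t h1 h2
  have a0 := norm_nonneg (x t - x 0)
  have b0 := norm_nonneg (y t - y 0)
  have e1 : ‖((x t, y t) : E × F) - (x 0, y 0)‖ = max ‖x t - x 0‖ ‖y t - y 0‖ := rfl
  rw [e1, Real.norm_of_nonneg (by positivity), Real.norm_of_nonneg (by positivity),
    Real.norm_of_nonneg (by positivity), Real.norm_of_nonneg (by positivity), one_mul]
  rcases max_choice ‖x t - x 0‖ ‖y t - y 0‖ with h | h <;> rw [h]
  · exact (pow_le_pow_of_le_one a0 h1 (Nat.le_add_right k l)).trans
      (le_add_of_nonneg_right (by positivity))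
  · exact (pow_le_pow_of_le_one b0 h2 (Nat.le_add_left l k)).trans
      (le_add_of_nonneg_left (by positivity))

/-- The pairing `⟨p, x⟩` of two extended points: pairing of representatives. -/
noncomputable def Ext.pair [Fact (1 ≤ n)] : (std n E).Ext → (std n F).Ext → (std n (E × F)).Ext :=
  Quotient.map₂ (sa := (std n E).pathSetoid) (sb := (std n F).pathSetoid)
    (sc := (std n (E × F)).pathSetoid)
    (fun x y => ⟨fun t => (x.1 t, y.1 t), isNilpotentPath_pair x.2 y.2⟩)
    fun x x' hx y y' hy => by
      refine (pathEquiv_std (isNilpotentPath_pair x.2 y.2) (isNilpotentPath_pair x'.2 y'.2)).2 ?_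
      exact ((pathEquiv_std x.2 x'.2).1 hx).prod_left ((pathEquiv_std y.2 y'.2).1 hy)

/-- Sum of representatives. -/
noncomputable instance [Fact (1 ≤ n)] : Add (std n E).Ext where
  add a b := Ext.map (fun q : E × E => q.1 + q.2) (isArrow_of_contDiff contDiff_add)
    (Ext.pair a b)

/-- Product of representatives. -/
noncomputable instance [Fact (1 ≤ n)] : SMul (std n ℝ).Ext (std n E).Ext where
  smul h a := Ext.map (fun q : ℝ × E => q.1 • q.2) (isArrow_of_contDiff contDiff_smul)
    (Ext.pair h a)

end Std

/-- The set `D ⊆ ·ℝ` of first order infinitesimals: those represented by an `x` with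
`x(t) = O(t)`. -/
def infinitesimals (n : ℕ∞) : Set (std n ℝ).Ext :=
  {h | ∃ (x : ℝ → ℝ) (hx : (std n ℝ).IsNilpotentPath x),
    h = Ext.mk (std n ℝ) x hx ∧ x =O[𝓝 0] (fun t : ℝ => t)}

theorem zero_mem_infinitesimals (n : ℕ∞) : Ext.const (std n ℝ) 0 ∈ infinitesimals n :=
  ⟨fun _ => 0, (std n ℝ).isNilpotentPath_const 0, rfl, isBigO_zero _ _⟩

end CnSpace

/-! ### The category of extended spaces -/

open CnSpace

/-- The objects of the category of types of figures for extended spaces: arbitrary subsets of some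
`·ℝˢ`. -/
structure ExtDomain (n : ℕ∞) where
  dim : ℕ
  carrier : Set (std n (Euc dim)).Ext

namespace ExtDomain

variable {n : ℕ∞}

instance : CoeSort (ExtDomain n) Type := ⟨fun T => T.carrier⟩

/-- The topology generated by the sets `·U ∩ T`, for `U` open in the Euclidean space. -/
instance (T : ExtDomain n) : TopologicalSpace T :=
  TopologicalSpace.generateFrom
    {O | ∃ U : Set (Euc T.dim), IsOpen U ∧ O = {x : T | x.1 ∈ (std n (Euc T.dim)).dot U}}

/-- Arrows: maps that locally are of the form `x ↦ ·g⟨p, x⟩`, for an extended parameter `p` and an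
ordinary `Cⁿ` map `g : U × V → ℝᵗ`. -/
def Hom [Fact (1 ≤ n)] (S T : ExtDomain n) (f : S → T) : Prop :=
  ∀ s : S, ∃ (m : ℕ) (p : (std n (Euc m)).Ext) (U : Set (Euc m)) (V : Set (Euc S.dim))
    (g : U ×ˢ V → Euc T.dim) (hg : ContDiffOn ℝ n (zeroExt g) (U ×ˢ V)),
    IsOpen U ∧ p ∈ (std n (Euc m)).dot U ∧
    IsOpen V ∧ s.1 ∈ (std n (Euc S.dim)).dot V ∧
    ∀ x : S, x.1 ∈ (std n (Euc S.dim)).dot V →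
      ∃ hx : Ext.pair p x.1 ∈ (std n (Euc m × Euc S.dim)).dot (U ×ˢ V),
        (f x).1 = Ext.mapOn g (isArrow_of_contDiffOn hg) ⟨Ext.pair p x.1, hx⟩

/-- The restriction of `S` to an open subset. -/
def restrict (S : ExtDomain n) (O : Set S) : ExtDomain n := ⟨S.dim, Subtype.val '' O⟩

end ExtDomain

/-- A family of figures on the set `A`, one set of figures for every type. -/
abbrev ExtFigures (n : ℕ∞) (A : Type*) := ∀ T : ExtDomain n, Set (T → A)

/-- The arrows of extended spaces take figures to figures of the same type. -/
def ExtFigures.IsArrow {n : ℕ∞} {A B : Type*} (P : ExtFigures n A) (Q : ExtFigures n B)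
    (f : A → B) : Prop :=
  ∀ T : ExtDomain n, ∀ d ∈ P T, f ∘ d ∈ Q T

/-- The figures generated by a given family: those that locally are a composition of an arrow with
a figure of the family. -/
def ExtFigures.generate {n : ℕ∞} [Fact (1 ≤ n)] {A : Type*} (P : ExtFigures n A) :
    ExtFigures n A :=
  fun S => {δ | ∀ s : S, ∃ (O : Set S) (T : ExtDomain n) (d : T → A) (f : S.restrict O → T),
    IsOpen O ∧ s ∈ O ∧ d ∈ P T ∧ (S.restrict O).Hom T f ∧
    ∀ (x : S) (hx : x ∈ O), δ x = d (f ⟨x.1, x, hx, rfl⟩)}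

namespace CnSpace

variable {n : ℕ∞} {S : Type*}

/-- A figure of `X` is an arrow from its domain. -/
theorem isArrow_of_mem_fig (X : CnSpace n S) {H : OpenDomain} {h : H → S} (hh : h ∈ X.fig H) :
    ((std n (Euc H.dim)).sub H.carrier).IsArrow X h :=
  fun _ _ hd => X.comp_mem hd hh

/-- The generating figures on a subset `Z` of the extension of `X`: the constant maps, and the maps
`·h|_T`, where `h : V → X` is a figure of `X` with `T ⊆ ·V`. -/
def generatingFigures (X : CnSpace n S) (Z : Set X.Ext) : ExtFigures n Z :=
  fun T => {d | (∃ z : Z, d = fun _ => z) ∨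
    ∃ (V : Set (Euc T.dim)) (hV : IsOpen V) (h : V → S) (hh : h ∈ X.fig ⟨T.dim, V, hV⟩)
      (hT : T.carrier ⊆ (std n (Euc T.dim)).dot V),
      ∀ x : T, (d x).1 = Ext.mapOn h (X.isArrow_of_mem_fig hh) ⟨x.1, hT x.2⟩}

/-- The figures of the extended space induced by `X` on a subset `Z` of its extension. -/
def inducedFigures [Fact (1 ≤ n)] (X : CnSpace n S) (Z : Set X.Ext) : ExtFigures n Z :=
  (X.generatingFigures Z).generate

/-- The figures of the extended space `·X`, which is the one induced by `X` on all of `·X`. -/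
def extFigures [Fact (1 ≤ n)] (X : CnSpace n S) : ExtFigures n X.Ext :=
  fun T => {d | (fun x => (⟨d x, trivial⟩ : (Set.univ : Set X.Ext))) ∈
    X.inducedFigures Set.univ T}

end CnSpace

/-!
Every point of `D` has standard part `0`, so the topology of `D` is indiscrete and an arrow
`f : D → ·X`, which is a figure of `·X` because the identity of `D` is a figure of `D`, is on all
of `D` either constant or of the form `h ↦ ·g⟨p, h⟩` for one arrow `g` and one extended parameter
`p`. In the second case `ψ = φ ∘ g` is of class `Cⁿ` near the standard part `(p₀, 0)` of `⟨p, 0⟩`,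
and its strict differentiability there gives
`ψ (p_t, h_t) = ψ (p_t, 0) + h_t ∂₂ψ (p₀, 0) + o(h_t)`. This is the expansion, with a standard
slope although `p` is not standard, because `h_t = O(t)`. The points `h = 0` and `h = [t]`
determine the two coefficients.
-/

theorem zeroExt_of_notMem {S E : Type*} [Zero E] {A : Set S} (f : A → E) {x : S} (hx : x ∉ A) :
    zeroExt f x = 0 :=
  Function.extend_apply' f _ x fun ⟨a, ha⟩ => hx (ha ▸ a.2)

theorem isLittleO_add_smul_of_hasStrictFDerivAt {𝕜 E F α : Type*} [NontriviallyNormedField 𝕜]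
    [NormedAddCommGroup E] [NormedSpace 𝕜 E] [NormedAddCommGroup F] [NormedSpace 𝕜 F]
    {g : E → F} {L : E →L[𝕜] F} {e : E} (hg : HasStrictFDerivAt g L e) {l : Filter α}
    {x : α → E} {r : α → 𝕜} (hx : Tendsto x l (𝓝 e)) (hr : Tendsto r l (𝓝 0)) (v : E) :
    (fun t => g (x t + r t • v) - (g (x t) + r t • L v)) =o[l] r := by
  have hxv : Tendsto (fun t => x t + r t • v) l (𝓝 e) := by
    simpa only [zero_smul, add_zero] using hx.add (hr.smul_const v)
  have hrv : (fun t => x t + r t • v - x t) =O[l] r :=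
    .of_bound ‖v‖ (.of_forall fun t => by rw [add_sub_cancel_left, norm_smul, mul_comm])
  refine ((hg.isLittleO.comp_tendsto (hxv.prodMk_nhds hx)).trans_isBigO hrv).congr_left fun t => ?_
  simp only [Function.comp_apply, add_sub_cancel_left, map_smul, sub_sub]

namespace CnSpace

variable {n : ℕ∞} {S S' S'' : Type*} {X : CnSpace n S} {Y : CnSpace n S'} {Z : CnSpace n S''}

theorem IsArrow.comp {g : S' → S''} {f : S → S'} (hg : Y.IsArrow Z g) (hf : X.IsArrow Y f) :
    X.IsArrow Z (g ∘ f) :=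
  fun H d hd => hg H (f ∘ d) (hf H d hd)

theorem IsArrow.restrictPreimage {f : S → S'} (hf : X.IsArrow Y f) (B : Set S') :
    (X.sub (f ⁻¹' B)).IsArrow (Y.sub B) (B.restrictPreimage f) :=
  fun H _ hd => hf H _ hd

theorem Ext.exists_rep (z : X.Ext) : ∃ (x : ℝ → S) (hx : X.IsNilpotentPath x), Ext.mk X x hx = z :=
  let ⟨⟨x, hx⟩, hz⟩ := Quotient.exists_rep z
  ⟨x, hx, hz⟩

theorem Ext.map_map {g : S' → S''} {f : S → S'} (hg : Y.IsArrow Z g) (hf : X.IsArrow Y f)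
    (z : X.Ext) : Ext.map g hg (Ext.map f hf z) = Ext.map (g ∘ f) (hg.comp hf) z := by
  obtain ⟨x, hx, rfl⟩ := z.exists_rep
  rfl

theorem IsNilpotentPath.congr {x y : ℝ → S} (hx : X.IsNilpotentPath x) (hxy : x =ᶠ[𝓝 0] y) :
    X.IsNilpotentPath y := by
  have hxy0 : x 0 = y 0 := hxy.self_of_nhds
  refine ⟨let := X.topology; ContinuousAt.congr hx.1 hxy, fun U K c hc hU => ?_⟩
  obtain ⟨k, hk⟩ := hx.2 U K c hc (hxy0 ▸ hU)
  refine ⟨k, hk.congr' ?_ .rfl⟩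
  filter_upwards [hxy] with t ht
  rw [ht, hxy0]

theorem Ext.mk_eq_mk_of_eventuallyEq {x y : ℝ → S} {hx : X.IsNilpotentPath x}
    {hy : X.IsNilpotentPath y} (hxy : x =ᶠ[𝓝 0] y) : Ext.mk X x hx = Ext.mk X y hy := by
  refine Ext.mk_eq_mk.2 fun U K c _ => ⟨by rw [hxy.self_of_nhds], fun _ => ?_⟩
  refine (isLittleO_zero _ _).congr' ?_ .rfl
  filter_upwards [hxy] with t ht
  rw [ht, sub_self]

theorem PathEquiv.mem_iff {x y : ℝ → S} (h : X.PathEquiv x y) {A : Set S}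
    (hA : IsOpen[X.topology] A) : x 0 ∈ A ↔ y 0 ∈ A :=
  -- Every open set is the domain of a constant observable.
  (h A ⟨0, Set.univ, isOpen_univ⟩ (fun _ => ⟨0, trivial⟩)
    ⟨hA, fun H _ _ => (bar n ⟨0, Set.univ, isOpen_univ⟩).const_mem H ⟨0, trivial⟩⟩).1

theorem isArrow_image_symm (A : Set S) (W : Set A) :
    (X.sub (Subtype.val '' W)).IsArrow ((X.sub A).sub W)
      (Equiv.Set.image Subtype.val W Subtype.val_injective).symm := by
  intro H d hd
  have hval (s : Subtype.val '' W) :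
      ((Equiv.Set.image Subtype.val W Subtype.val_injective).symm s).1.1 = s.1 :=
    congrArg Subtype.val
      ((Equiv.Set.image Subtype.val W Subtype.val_injective).apply_symm_apply s)
  change (fun v => _) ∈ X.fig H
  simp only [Function.comp_apply, hval]
  exact hd

theorem IsObservable.exists_of_sub {A : Set S} (hA : IsOpen[X.topology] A) {W : Set A}
    {K : OpenDomain} {c : W → K} (hc : (X.sub A).IsObservable W K c) :
    ∃ c' : (Subtype.val '' W : Set S) → K, X.IsObservable (Subtype.val '' W) K c' ∧
      ∀ a : A, obs c' a = obs c a := by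
  refine ⟨c ∘ (Equiv.Set.image Subtype.val W Subtype.val_injective).symm,
    ⟨isOpen_image_val hA hc.1, hc.2.comp (isArrow_image_symm A W)⟩, fun a => ?_⟩
  by_cases ha : a ∈ W
  · have ha' : (a : S) ∈ Subtype.val '' W := Set.mem_image_of_mem _ ha
    rw [obs, obs, zeroExt_of_mem _ ha, zeroExt_of_mem _ ha', Function.comp_apply,
      Equiv.Set.image_symm_apply]
  · rw [obs, obs, zeroExt_of_notMem _ ha,
      zeroExt_of_notMem _ (Subtype.val_injective.mem_set_image.not.2 ha)]

theorem IsNilpotentPath.of_val {A : Set S} (hA : IsOpen[X.topology] A) {x : ℝ → A}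
    (hx : X.IsNilpotentPath (Subtype.val ∘ x)) : (X.sub A).IsNilpotentPath x := by
  refine ⟨?_, fun W K c hc h0 => ?_⟩
  · let := X.topology
    let := (X.sub A).topology
    have hval : IsOpenMap (Subtype.val : A → S) := fun W hW => isOpen_image_val hA hW
    intro s hs
    exact mem_of_superset (hx.1 (hval.image_mem_nhds hs)) fun t ht =>
      Subtype.val_injective.mem_set_image.1 ht
  · obtain ⟨c', hc', hcc'⟩ := hc.exists_of_sub hA
    obtain ⟨k, hk⟩ := hx.2 _ K c' hc' (Set.mem_image_of_mem Subtype.val h0)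
    exact ⟨k, by simpa only [Function.comp_apply, hcc'] using hk⟩

theorem IsNilpotentPath.exists_lift {A : Set S} (hA : IsOpen[X.topology] A) {x : ℝ → S}
    (hx : X.IsNilpotentPath x) (h0 : x 0 ∈ A) :
    ∃ y : ℝ → A, (X.sub A).IsNilpotentPath y ∧ Subtype.val ∘ y =ᶠ[𝓝 0] x := by
  classical
  let y : ℝ → A := fun t => if h : x t ∈ A then ⟨x t, h⟩ else ⟨x 0, h0⟩
  have hxA : ∀ᶠ t in 𝓝 0, x t ∈ A :=
    let := X.topology
    hx.1.preimage_mem_nhds (hA.mem_nhds h0)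
  have hyx : Subtype.val ∘ y =ᶠ[𝓝 0] x := by
    filter_upwards [hxA] with t ht
    simp only [y, Function.comp_apply, dif_pos ht]
  exact ⟨y, .of_val hA (hx.congr hyx.symm), hyx⟩

theorem Ext.mk_mem_dot {A : Set S} (hA : IsOpen[X.topology] A) {x : ℝ → S}
    (hx : X.IsNilpotentPath x) : Ext.mk X x hx ∈ X.dot A ↔ x 0 ∈ A := by
  constructor
  · rintro ⟨u, hu⟩
    obtain ⟨y, hy, rfl⟩ := u.exists_rep
    have hyx : X.PathEquiv (Subtype.val ∘ y) x := Ext.mk_eq_mk.1 hu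
    exact (hyx.mem_iff hA).1 (y 0).2
  · intro h0
    obtain ⟨y, hy, hyx⟩ := hx.exists_lift hA h0
    exact ⟨Ext.mk _ y hy, Ext.mk_eq_mk_of_eventuallyEq hyx⟩

theorem Ext.map_mem_dot {f : S → S'} (hf : X.IsArrow Y f) {B : Set S'}
    (hB : IsOpen[Y.topology] B) {z : X.Ext} : Ext.map f hf z ∈ Y.dot B ↔ z ∈ X.dot (f ⁻¹' B) := by
  obtain ⟨x, hx, rfl⟩ := z.exists_rep
  have hfB : IsOpen[X.topology] (f ⁻¹' B) := fun H d hd => hB H (f ∘ d) (hf H d hd)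
  rw [Ext.mk_mem_dot hfB hx]
  exact Ext.mk_mem_dot hB (hf.isNilpotentPath hx)

/-- An arrow `(dom ≺ X) → Y` on an open subset `dom` of `X`. -/
structure PartialArrow (X : CnSpace n S) (Y : CnSpace n S') where
  dom : Set S
  isOpen_dom : IsOpen[X.topology] dom
  toFun : dom → S'
  isArrow : (X.sub dom).IsArrow Y toFun

namespace PartialArrow

/-- The graph of the extension of a partial arrow: `z` lies in `·dom` and `·f` takes it to `w`. A
relation is used instead of `Ext.mapOn` in order to compose without carrying membership proofs. -/
def HasExtValue (f : PartialArrow X Y) (z : X.Ext) (w : Y.Ext) : Prop :=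
  ∃ u : (X.sub f.dom).Ext,
    Ext.map Subtype.val (X.isArrow_val f.dom) u = z ∧ Ext.map f.toFun f.isArrow u = w

theorem hasExtValue_iff_mapOn {f : PartialArrow X Y} {z : X.Ext} {w : Y.Ext} :
    f.HasExtValue z w ↔ ∃ hz : z ∈ X.dot f.dom, Ext.mapOn f.toFun f.isArrow ⟨z, hz⟩ = w := by
  constructor
  · rintro ⟨u, rfl, rfl⟩
    exact ⟨⟨u, rfl⟩, Ext.mapOn_map f.isOpen_dom f.toFun f.isArrow u⟩
  · rintro ⟨⟨u, rfl⟩, rfl⟩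
    exact ⟨u, rfl, (Ext.mapOn_map f.isOpen_dom f.toFun f.isArrow u).symm⟩

theorem HasExtValue.unique {f : PartialArrow X Y} {z : X.Ext} {w w' : Y.Ext}
    (hw : f.HasExtValue z w) (hw' : f.HasExtValue z w') : w = w' := by
  obtain ⟨_, rfl⟩ := hasExtValue_iff_mapOn.1 hw
  obtain ⟨_, rfl⟩ := hasExtValue_iff_mapOn.1 hw'
  rfl

theorem exists_hasExtValue_mk (f : PartialArrow X Y) {x : ℝ → S} (hx : X.IsNilpotentPath x)
    (h0 : x 0 ∈ f.dom) :
    ∃ (y : ℝ → f.dom) (hy : Y.IsNilpotentPath (f.toFun ∘ y)), Subtype.val ∘ y =ᶠ[𝓝 0] x ∧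
      f.HasExtValue (Ext.mk X x hx) (Ext.mk Y (f.toFun ∘ y) hy) :=
  let ⟨y, hy, hyx⟩ := hx.exists_lift f.isOpen_dom h0
  ⟨y, f.isArrow.isNilpotentPath hy, hyx, Ext.mk _ y hy, Ext.mk_eq_mk_of_eventuallyEq hyx, rfl⟩

/-- The partial arrow `g ∘ f`, for a globally defined arrow `f`. -/
def precomp (g : PartialArrow Y Z) {f : S → S'} (hf : X.IsArrow Y f) : PartialArrow X Z where
  dom := f ⁻¹' g.dom
  isOpen_dom H d hd := g.isOpen_dom H (f ∘ d) (hf H d hd)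
  toFun := g.toFun ∘ g.dom.restrictPreimage f
  isArrow := g.isArrow.comp (hf.restrictPreimage g.dom)

theorem precomp_hasExtValue_iff {g : PartialArrow Y Z} {f : S → S'} {hf : X.IsArrow Y f}
    {z : X.Ext} {w : Z.Ext} :
    (g.precomp hf).HasExtValue z w ↔ g.HasExtValue (Ext.map f hf z) w := by
  have hf' := hf.restrictPreimage g.dom
  constructor
  · rintro ⟨u, rfl, rfl⟩
    refine ⟨Ext.map _ hf' u, ?_, Ext.map_map g.isArrow hf' u⟩
    exact (Ext.map_map _ hf' u).trans (Ext.map_map hf _ u).symm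
  · rintro ⟨u, hu, rfl⟩
    obtain ⟨v, rfl⟩ := (Ext.map_mem_dot hf g.isOpen_dom).1 ⟨u, hu⟩
    have hvu : Ext.map _ hf' v = u := by
      refine Ext.map_val_injective g.isOpen_dom ?_
      rw [hu, Ext.map_map, Ext.map_map]
      rfl
    exact ⟨v, rfl, by rw [← hvu, Ext.map_map]; rfl⟩

/-- A partial arrow on an open subspace `(A ≺ X)`, regarded as a partial arrow on `X`. -/
noncomputable def ofSub {A : Set S} (hA : IsOpen[X.topology] A) (g : PartialArrow (X.sub A) Y) :
    PartialArrow X Y where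
  dom := Subtype.val '' g.dom
  isOpen_dom := isOpen_image_val hA g.isOpen_dom
  toFun := g.toFun ∘ (Equiv.Set.image Subtype.val g.dom Subtype.val_injective).symm
  isArrow := g.isArrow.comp (isArrow_image_symm A g.dom)

theorem ofSub_hasExtValue_iff {A : Set S} {hA : IsOpen[X.topology] A}
    {g : PartialArrow (X.sub A) Y} {u : (X.sub A).Ext} {w : Y.Ext} :
    (g.ofSub hA).HasExtValue (Ext.map Subtype.val (X.isArrow_val A) u) w ↔ g.HasExtValue u w := by
  let e := Equiv.Set.image Subtype.val g.dom Subtype.val_injective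
  have hsymm : (X.sub (Subtype.val '' g.dom)).IsArrow ((X.sub A).sub g.dom) e.symm :=
    isArrow_image_symm A g.dom
  have he : ((X.sub A).sub g.dom).IsArrow (X.sub (Subtype.val '' g.dom)) e := fun _ _ hd => hd
  constructor
  · rintro ⟨v, hv, rfl⟩
    obtain ⟨x, hx, rfl⟩ := v.exists_rep
    refine ⟨Ext.map _ hsymm (Ext.mk _ x hx), Ext.map_val_injective hA (Eq.trans ?_ hv), rfl⟩
    exact Ext.mk_eq_mk_of_eventuallyEq (.of_eq (funext fun t =>
      congrArg Subtype.val (e.apply_symm_apply (x t))))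
  · rintro ⟨v, rfl, rfl⟩
    obtain ⟨x, hx, rfl⟩ := v.exists_rep
    refine ⟨Ext.map _ he (Ext.mk _ x hx), rfl, ?_⟩
    exact Ext.mk_eq_mk_of_eventuallyEq (.of_eq (funext fun t =>
      congrArg g.toFun (e.symm_apply_apply (x t))))

/-- The composition of partial arrows, defined where `f` takes values in the domain of `g`. -/
noncomputable def comp (g : PartialArrow Y Z) (f : PartialArrow X Y) : PartialArrow X Z :=
  (g.precomp f.isArrow).ofSub f.isOpen_dom

theorem HasExtValue.comp_iff {g : PartialArrow Y Z} {f : PartialArrow X Y} {z : X.Ext} {v : Y.Ext}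
    (hf : f.HasExtValue z v) {w : Z.Ext} : (g.comp f).HasExtValue z w ↔ g.HasExtValue v w := by
  obtain ⟨u, rfl, rfl⟩ := hf
  exact ofSub_hasExtValue_iff.trans precomp_hasExtValue_iff

end PartialArrow

section Std

variable {E F : Type*} [NormedAddCommGroup E] [NormedSpace ℝ E] [FiniteDimensional ℝ E]
  [NormedAddCommGroup F] [NormedSpace ℝ F]

theorem IsArrow.contDiffOn {U : Set E} (hU : IsOpen U) {c : U → F}
    (hc : ((std n E).sub U).IsArrow (std n F) c) : ContDiffOn ℝ n (zeroExt c) U := by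
  let e := toEuclidean (E := E)
  let i : chartDomain U hU → U := fun v => ⟨e.symm v.1, v.2⟩
  have hci : ContDiffOn ℝ n (zeroExt (c ∘ i)) (e.symm ⁻¹' U) := hc _ i (chart_mem_fig U hU)
  have heU : Set.MapsTo e U (e.symm ⁻¹' U) := fun x hx => by
    rwa [Set.mem_preimage, e.symm_apply_apply]
  refine (hci.comp e.contDiff.contDiffOn heU).congr fun x hx => ?_
  have hix : i ⟨e x, heU hx⟩ = ⟨x, hx⟩ := Subtype.ext (e.symm_apply_apply x)
  rw [Function.comp_apply, zeroExt_of_mem _ hx,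
    zeroExt_of_mem (A := (chartDomain U hU).carrier) _ (heU hx), Function.comp_apply, hix]

theorem PartialArrow.contDiffOn (f : PartialArrow (std n E) (std n F)) :
    ContDiffOn ℝ n (zeroExt f.toFun) f.dom :=
  f.isArrow.contDiffOn (isOpen_std.1 f.isOpen_dom)

theorem PathEquiv.apply_zero_eq {x y : ℝ → E} (h : (std n E).PathEquiv x y) : x 0 = y 0 :=
  (inseparable_iff_forall_isOpen.2 fun _ hU => h.mem_iff (isOpen_std.2 hU)).eq

/-- The standard part `x 0` of the extended point `[x]`. -/
def Ext.standardPart : (std n E).Ext → E :=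
  Quotient.lift (s := (std n E).pathSetoid) (fun x => x.1 0) fun _ _ h => h.apply_zero_eq

theorem Ext.standardPart_mk {x : ℝ → E} (hx : (std n E).IsNilpotentPath x) :
    (Ext.mk (std n E) x hx).standardPart = x 0 :=
  rfl

theorem Ext.mem_dot_iff {U : Set E} (hU : IsOpen U) {z : (std n E).Ext} :
    z ∈ (std n E).dot U ↔ z.standardPart ∈ U := by
  obtain ⟨x, hx, rfl⟩ := z.exists_rep
  exact Ext.mk_mem_dot (isOpen_std.2 hU) hx

theorem PartialArrow.HasExtValue.standardPart_mem {f : PartialArrow (std n E) Y}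
    {z : (std n E).Ext} {w : Y.Ext} (hf : f.HasExtValue z w) : z.standardPart ∈ f.dom :=
  (Ext.mem_dot_iff (isOpen_std.1 f.isOpen_dom)).1 (hasExtValue_iff_mapOn.1 hf).1

theorem standardPart_eq_zero_of_mem_infinitesimals {h : (std n ℝ).Ext} (hh : h ∈ infinitesimals n) :
    h.standardPart = 0 := by
  obtain ⟨x, hx, rfl, hxO⟩ := hh
  exact hxO.eq_zero_imp.self_of_nhds rfl

variable [FiniteDimensional ℝ F] [Fact (1 ≤ n)]

theorem isNilpotentPath_of_isBigO {x : ℝ → E} (hx : x =O[𝓝 0] fun t : ℝ => t) :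
    (std n E).IsNilpotentPath x := by
  have hx0 : x 0 = 0 := hx.eq_zero_imp.self_of_nhds rfl
  refine isNilpotentPath_std.2 ⟨2, ?_⟩
  simp only [hx0, sub_zero]
  exact (hx.norm_left.pow 2).trans_isLittleO (isLittleO_pow_id one_lt_two)

theorem isNilpotentPath_add_smul_const {x : ℝ → E} {r : ℝ → ℝ} (hx : (std n E).IsNilpotentPath x)
    (hr : (std n ℝ).IsNilpotentPath r) (v : E) :
    (std n E).IsNilpotentPath fun t => x t + r t • v :=
  (isArrow_of_contDiff (g := fun q : E × ℝ => q.1 + q.2 • v) (by fun_prop)).isNilpotentPath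
    (isNilpotentPath_pair hx hr)

theorem Ext.mk_add_smul_const {x : ℝ → E} {r : ℝ → ℝ} (hx : (std n E).IsNilpotentPath x)
    (hr : (std n ℝ).IsNilpotentPath r) (v : E) :
    Ext.mk _ x hx + Ext.mk _ r hr • Ext.const (std n E) v =
      Ext.mk _ _ (isNilpotentPath_add_smul_const hx hr v) :=
  rfl

theorem Ext.add_zero_smul_const (a : (std n E).Ext) (v : E) :
    a + Ext.const (std n ℝ) 0 • Ext.const (std n E) v = a := by
  obtain ⟨x, hx, rfl⟩ := a.exists_rep
  exact (Ext.mk_add_smul_const hx _ v).trans (Ext.mk_eq_mk_of_eventuallyEq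
    (.of_forall fun t => by simp only [zero_smul, add_zero]))

theorem Ext.add_smul_const_zero (a : (std n E).Ext) (h : (std n ℝ).Ext) :
    a + h • Ext.const (std n E) 0 = a := by
  obtain ⟨x, hx, rfl⟩ := a.exists_rep
  obtain ⟨r, hr, rfl⟩ := h.exists_rep
  exact (Ext.mk_add_smul_const hx hr 0).trans (Ext.mk_eq_mk_of_eventuallyEq
    (.of_forall fun t => by simp only [smul_zero, add_zero]))

theorem Ext.pair_eq_add_smul_const (p : (std n E).Ext) (h : (std n ℝ).Ext) :
    Ext.pair p h = Ext.pair p (Ext.const (std n ℝ) 0) + h • Ext.const (std n (E × ℝ)) (0, 1) := by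
  obtain ⟨x, hx, rfl⟩ := p.exists_rep
  obtain ⟨r, hr, rfl⟩ := h.exists_rep
  have hx0 := isNilpotentPath_pair hx ((std n ℝ).isNilpotentPath_const 0)
  refine (Ext.mk_eq_mk_of_eventuallyEq (.of_forall fun t => ?_)).trans
    (Ext.mk_add_smul_const hx0 hr (0, 1)).symm
  simp only [Prod.smul_mk, Prod.mk_add_mk, smul_zero, add_zero, smul_eq_mul, mul_one, zero_add]

theorem PartialArrow.HasExtValue.add_smul_const {f : PartialArrow (std n E) (std n F)}
    {z : (std n E).Ext} {a : (std n F).Ext} (ha : f.HasExtValue z a) {h : (std n ℝ).Ext}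
    (hh : h ∈ infinitesimals n) (v : E) :
    f.HasExtValue (z + h • Ext.const (std n E) v)
      (a + h • Ext.const (std n F) (fderiv ℝ (zeroExt f.toFun) z.standardPart v)) := by
  obtain ⟨x, hx, rfl⟩ := z.exists_rep
  obtain ⟨r, hr, rfl, hrO⟩ := hh
  have hr0 : r 0 = 0 := hrO.eq_zero_imp.self_of_nhds rfl
  have hx0 : x 0 ∈ f.dom := ha.standardPart_mem
  have hn : (n : WithTop ℕ∞) ≠ 0 := by
    exact_mod_cast (one_pos.trans_le (Fact.out : 1 ≤ n)).ne'
  have hf : HasStrictFDerivAt (zeroExt f.toFun) (fderiv ℝ (zeroExt f.toFun) (x 0)) (x 0) :=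
    (f.contDiffOn.contDiffAt ((isOpen_std.1 f.isOpen_dom).mem_nhds hx0)).hasStrictFDerivAt hn
  obtain ⟨y, hy, hyx, hfy⟩ := f.exists_hasExtValue_mk hx hx0
  obtain ⟨y', hy', hyx', hfy'⟩ := f.exists_hasExtValue_mk
    (isNilpotentPath_add_smul_const hx hr v) (by rwa [hr0, zero_smul, add_zero])
  obtain rfl := ha.unique hfy
  rw [Ext.mk_add_smul_const, Ext.mk_add_smul_const, Ext.standardPart_mk]
  suffices Ext.mk _ _ hy' = Ext.mk _ _ (isNilpotentPath_add_smul_const hy hr _) from this ▸ hfy'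
  refine Ext.mk_eq_mk.2 ((pathEquiv_std hy' (isNilpotentPath_add_smul_const hy hr _)).2 ?_)
  have htaylor := isLittleO_add_smul_of_hasStrictFDerivAt hf hx.tendsto (hr0 ▸ hr.tendsto) v
  refine (htaylor.trans_isBigO hrO).congr' ?_ .rfl
  filter_upwards [hyx, hyx'] with t ht ht'
  rw [← ht', ← ht, Function.comp_apply, Function.comp_apply, zeroExt_of_mem _ (y t).2,
    zeroExt_of_mem _ (y' t).2]
  rfl

theorem Ext.affine_injective {a a' : (std n E).Ext} {b b' : E}
    (hab : ∀ h ∈ infinitesimals n,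
      a + h • Ext.const (std n E) b = a' + h • Ext.const (std n E) b') : a = a' ∧ b = b' := by
  obtain rfl : a = a' := by
    simpa only [Ext.add_zero_smul_const] using hab _ (zero_mem_infinitesimals n)
  refine ⟨rfl, ?_⟩
  obtain ⟨x, hx, rfl⟩ := a.exists_rep
  have hid : (std n ℝ).IsNilpotentPath id := isNilpotentPath_of_isBigO (isBigO_refl _ _)
  have hb : (fun t : ℝ => x t + t • b - (x t + t • b')) =o[𝓝 0] fun t : ℝ => t :=
    (pathEquiv_std (isNilpotentPath_add_smul_const hx hid b)
      (isNilpotentPath_add_smul_const hx hid b')).1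
      (Ext.mk_eq_mk.1 (hab _ ⟨id, hid, rfl, isBigO_refl _ _⟩))
  -- `t • b = t • b' + o(t)` says that `t ↦ t • b` has the derivative `b'` at `0`.
  have hb' : HasDerivAt (fun t : ℝ => t • b) b' 0 := by
    rw [hasDerivAt_iff_isLittleO]
    simpa only [sub_zero, zero_smul, add_sub_add_left_eq_sub] using hb
  simpa only [one_smul] using ((hasDerivAt_id' (0 : ℝ)).smul_const b).unique hb'

end Std

section Coordinates

variable {E F : Type*} [NormedAddCommGroup E] [NormedSpace ℝ E] [FiniteDimensional ℝ E]

theorem Ext.mapOn_restrict {f : S → S'} (hf : X.IsArrow Y f) {A : Set S}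
    (hA : IsOpen[X.topology] A) (hfA : (X.sub A).IsArrow Y fun a => f a) (z : X.dot A) :
    Ext.mapOn (fun a : A => f a) hfA z = Ext.map f hf z := by
  obtain ⟨_, u, rfl⟩ := z
  exact (Ext.mapOn_map hA _ hfA u).trans (Ext.map_map hf (X.isArrow_val A) u).symm

theorem Ext.mem_dot_univ (z : (std n E).Ext) : z ∈ (std n E).dot Set.univ :=
  (Ext.mem_dot_iff isOpen_univ).2 trivial

/-- The linear coordinates of an extended point of `E`. -/
noncomputable def Ext.coord (z : (std n E).Ext) : (std n (Euc (Module.finrank ℝ E))).Ext :=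
  Ext.map toEuclidean (isArrow_of_contDiff toEuclidean.contDiff) z

theorem Ext.map_toEuclidean_symm_coord (z : (std n E).Ext) :
    Ext.map toEuclidean.symm (isArrow_of_contDiff toEuclidean.symm.contDiff) z.coord = z := by
  obtain ⟨x, hx, rfl⟩ := z.exists_rep
  exact Ext.mk_eq_mk_of_eventuallyEq (.of_forall fun t => toEuclidean.symm_apply_apply (x t))

theorem Ext.standardPart_coord (z : (std n E).Ext) :
    z.coord.standardPart = toEuclidean z.standardPart := by
  obtain ⟨x, hx, rfl⟩ := z.exists_rep
  rfl

/-- The set of linear coordinates of the points of `Z ⊆ ·E`, as a type of figures. -/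
noncomputable abbrev coordDomain (Z : Set (std n E).Ext) : ExtDomain n where
  dim := Module.finrank ℝ E
  carrier := Ext.map toEuclidean.symm (isArrow_of_contDiff toEuclidean.symm.contDiff) ⁻¹' Z

/-- The inverse of the linear coordinates on `Z ⊆ ·E`. -/
noncomputable def coordMap (Z : Set (std n E).Ext) (v : coordDomain Z) : Z := ⟨_, v.2⟩

variable [Fact (1 ≤ n)] [NormedAddCommGroup F] [NormedSpace ℝ F] [FiniteDimensional ℝ F]

theorem Ext.map_snd_pair (p : (std n E).Ext) (z : (std n F).Ext) :
    Ext.map Prod.snd (isArrow_of_contDiff contDiff_snd) (Ext.pair p z) = z := by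
  obtain ⟨x, hx, rfl⟩ := p.exists_rep
  obtain ⟨y, hy, rfl⟩ := z.exists_rep
  rfl

theorem Ext.pair_coord (p : (std n E).Ext) (z : (std n F).Ext) :
    Ext.pair p z.coord = Ext.map (fun q : E × F => (q.1, toEuclidean q.2))
      (isArrow_of_contDiff (by fun_prop)) (Ext.pair p z) := by
  obtain ⟨x, hx, rfl⟩ := p.exists_rep
  obtain ⟨y, hy, rfl⟩ := z.exists_rep
  rfl

end Coordinates

end CnSpace

theorem ExtDomain.inseparable_of_standardPart_eq {n : ℕ∞} {T : ExtDomain n} {s s' : T}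
    (h : s.1.standardPart = s'.1.standardPart) : Inseparable s s' := by
  have hmem (O : Set T) (hO : ∃ U, IsOpen U ∧ O = {x : T | x.1 ∈ (std n (Euc T.dim)).dot U}) :
      s ∈ O ↔ s' ∈ O := by
    obtain ⟨U, hU, rfl⟩ := hO
    simp only [Set.mem_ofPred_eq, Ext.mem_dot_iff hU, h]
  simp only [Inseparable, TopologicalSpace.nhds_generateFrom, Set.mem_ofPred_eq]
  exact iInf_congr fun O => iInf_congr_Prop (and_congr_left (hmem O)) fun _ => rfl

theorem ExtDomain.hom_inclusion {n : ℕ∞} [Fact (1 ≤ n)] (T : ExtDomain n) (O : Set T) :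
    (T.restrict O).Hom T fun x => ⟨x.1, Subtype.coe_image_subset _ O x.2⟩ := by
  intro s
  have hsnd : ContDiffOn ℝ n (zeroExt fun q : (Set.univ ×ˢ Set.univ : Set (Euc 0 × Euc T.dim)) =>
      q.1.2) (Set.univ ×ˢ Set.univ) :=
    contDiff_snd.contDiffOn.congr fun _ hq => zeroExt_of_mem _ hq
  refine ⟨0, Ext.const _ 0, Set.univ, Set.univ, _, hsnd, isOpen_univ, Ext.mem_dot_univ _,
    isOpen_univ, Ext.mem_dot_univ _, fun x _ => ⟨?_, ?_⟩⟩
  · exact (Ext.mem_dot_iff (isOpen_univ.prod isOpen_univ)).2 ⟨trivial, trivial⟩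
  · exact ((Ext.mapOn_restrict (isArrow_of_contDiff contDiff_snd)
      (isOpen_std.2 (isOpen_univ.prod isOpen_univ)) _ _).trans
      (Ext.map_snd_pair (Ext.const (std n (Euc 0)) 0) x.1)).symm

theorem ExtFigures.mem_generate {n : ℕ∞} [Fact (1 ≤ n)] {A : Type*} {P : ExtFigures n A}
    {T : ExtDomain n} {d : T → A} (hd : d ∈ P T) : d ∈ P.generate T :=
  fun _ => ⟨Set.univ, T, d, _, isOpen_univ, trivial, hd, T.hom_inclusion _, fun _ _ => rfl⟩

theorem ExtDomain.Hom.exists_partialArrow {n : ℕ∞} [Fact (1 ≤ n)] {T T' : ExtDomain n}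
    {f : T → T'} (hf : T.Hom T' f) (s : T) :
    ∃ (m : ℕ) (p : (std n (Euc m)).Ext)
      (g : PartialArrow (std n (Euc m × Euc T.dim)) (std n (Euc T'.dim))),
      ∀ x : T, x.1.standardPart = s.1.standardPart → g.HasExtValue (Ext.pair p x.1) (f x).1 := by
  obtain ⟨m, p, U, V, g, hg, hU, -, hV, hs, hfg⟩ := hf s
  refine ⟨m, p, ⟨U ×ˢ V, isOpen_std.2 (hU.prod hV), g, isArrow_of_contDiffOn hg⟩, fun x hx => ?_⟩
  obtain ⟨hpx, hfx⟩ := hfg x ((Ext.mem_dot_iff hV).2 (hx ▸ (Ext.mem_dot_iff hV).1 hs))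
  exact PartialArrow.hasExtValue_iff_mapOn.2 ⟨hpx, hfx.symm⟩

namespace CnSpace

variable {n : ℕ∞} [Fact (1 ≤ n)] {S : Type*} {X : CnSpace n S} {E F : Type*}
  [NormedAddCommGroup E] [NormedSpace ℝ E] [FiniteDimensional ℝ E]
  [NormedAddCommGroup F] [NormedSpace ℝ F] [FiniteDimensional ℝ F]

theorem coordMap_mem_inducedFigures (Z : Set (std n E).Ext) :
    coordMap Z ∈ (std n E).inducedFigures Z (coordDomain Z) :=
  ExtFigures.mem_generate <| Or.inr ⟨Set.univ, isOpen_univ, _, chart_mem_fig Set.univ isOpen_univ,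
    fun _ _ => Ext.mem_dot_univ _, fun x =>
      (Ext.mapOn_restrict (isArrow_of_contDiff toEuclidean.symm.contDiff)
        (isOpen_std.2 isOpen_univ) _ ⟨x.1, Ext.mem_dot_univ x.1⟩).symm⟩

/-- On the monad of `s`, that is at the points of `Z ⊆ ·E` with the standard part of `s`, the map
`δ` is constant or of the form `x ↦ ·g⟨p, x⟩`, for an extended parameter `p` and a partial arrow
`g`. The first case is not an instance of the second: a point of `·X` need not be a value of the
extension of a partial arrow on a normed space. -/
def IsParametrizedAt {Z : Set (std n E).Ext} (δ : Z → X.Ext) (s : Z) : Prop :=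
  (∀ x : Z, x.1.standardPart = s.1.standardPart → δ x = δ s) ∨
  ∃ (m : ℕ) (p : (std n (Euc m)).Ext) (g : PartialArrow (std n (Euc m × E)) X),
    ∀ x : Z, x.1.standardPart = s.1.standardPart → g.HasExtValue (Ext.pair p x.1) (δ x)

theorem isParametrizedAt_of_mem_extFigures {T : ExtDomain n} {δ : T → X.Ext}
    (hδ : δ ∈ X.extFigures T) (s : T) : IsParametrizedAt δ s := by
  obtain ⟨O, T', d, f, hO, hsO, hd, hf, hδf⟩ := hδ s
  have hxO (x : T) (hx : x.1.standardPart = s.1.standardPart) : x ∈ O :=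
    ((ExtDomain.inseparable_of_standardPart_eq hx).mem_open_iff hO).2 hsO
  have hδx (x : T) (hx : x ∈ O) : δ x = (d (f ⟨x.1, x, hx, rfl⟩)).1 :=
    congrArg Subtype.val (hδf x hx)
  rcases hd with ⟨z, rfl⟩ | ⟨V, hV, h, hh, hT', hdh⟩
  · exact Or.inl fun x hx => (hδx x (hxO x hx)).trans (hδx s hsO).symm
  · obtain ⟨m, p, g, hg⟩ := hf.exists_partialArrow ⟨s.1, s, hsO, rfl⟩
    let h' : PartialArrow (std n (Euc T'.dim)) X :=
      ⟨V, isOpen_std.2 hV, h, X.isArrow_of_mem_fig hh⟩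
    refine Or.inr ⟨m, p, h'.comp g, fun x hx => (hg ⟨x.1, x, hxO x hx, rfl⟩ hx).comp_iff.2 ?_⟩
    rw [hδx x (hxO x hx)]
    exact PartialArrow.hasExtValue_iff_mapOn.2 ⟨hT' (f _).2, (hdh _).symm⟩

theorem isParametrizedAt_of_isArrow {Z : Set (std n E).Ext} {f : Z → X.Ext}
    (hf : ExtFigures.IsArrow ((std n E).inducedFigures Z) X.extFigures f) (s : Z) :
    IsParametrizedAt f s := by
  let coord (x : Z) : coordDomain Z :=
    ⟨x.1.coord, Set.mem_preimage.2 ((Ext.map_toEuclidean_symm_coord x.1).symm ▸ x.2)⟩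
  have hcoord (x : Z) : coordMap Z (coord x) = x :=
    Subtype.ext (Ext.map_toEuclidean_symm_coord x.1)
  have hmonad (x : Z) (hx : x.1.standardPart = s.1.standardPart) :
      (coord x).1.standardPart = (coord s).1.standardPart := by
    rw [Ext.standardPart_coord, Ext.standardPart_coord, hx]
  rcases isParametrizedAt_of_mem_extFigures (hf _ _ (coordMap_mem_inducedFigures Z)) (coord s) with
    hconst | ⟨m, p, g, hg⟩
  · refine Or.inl fun x hx => ?_
    simpa only [Function.comp_apply, hcoord] using hconst (coord x) (hmonad x hx)
  · have hcoordArrow : (std n (Euc m × E)).IsArrow (std n (Euc m × Euc (Module.finrank ℝ E)))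
        fun q => (q.1, toEuclidean q.2) := isArrow_of_contDiff (by fun_prop)
    refine Or.inr ⟨m, p, g.precomp hcoordArrow, fun x hx => ?_⟩
    rw [PartialArrow.precomp_hasExtValue_iff, ← Ext.pair_coord]
    simpa only [Function.comp_apply, hcoord] using hg (coord x) (hmonad x hx)

theorem IsParametrizedAt.exists_hasExtValue_add_smul_const {f : infinitesimals n → X.Ext}
    (hf : IsParametrizedAt f ⟨_, zero_mem_infinitesimals n⟩) {φ : PartialArrow X (std n F)}
    {a : (std n F).Ext} (ha : φ.HasExtValue (f ⟨_, zero_mem_infinitesimals n⟩) a) :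
    ∃ b : F, ∀ h, φ.HasExtValue (f h) (a + h.1 • Ext.const (std n F) b) := by
  have hst (h : infinitesimals n) : h.1.standardPart = (Ext.const (std n ℝ) 0).standardPart :=
    standardPart_eq_zero_of_mem_infinitesimals h.2
  rcases hf with hconst | ⟨m, p, g, hg⟩
  · exact ⟨0, fun h => by rwa [Ext.add_smul_const_zero, hconst h (hst h)]⟩
  · have hψ : (φ.comp g).HasExtValue (Ext.pair p (Ext.const _ 0)) a := (hg _ rfl).comp_iff.2 ha
    refine ⟨fderiv ℝ (zeroExt (φ.comp g).toFun) (Ext.pair p (Ext.const _ 0)).standardPart (0, 1),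
      fun h => (hg h (hst h)).comp_iff.1 ?_⟩
    rw [Ext.pair_eq_add_smul_const]
    exact hψ.add_smul_const h.2 (0, 1)

end CnSpace

theorem mainTheorem2_general {n : ℕ∞} [Fact (1 ≤ n)] {S : Type*} (X : CnSpace n S) {F : Type*}
    [NormedAddCommGroup F] [NormedSpace ℝ F] [FiniteDimensional ℝ F]
    {U : Set S} (hU : IsOpen[X.topology] U)
    (φ : U → F) (hφ : (X.sub U).IsArrow (std n F) φ)
    (f : infinitesimals n → X.Ext)
    (hf : ExtFigures.IsArrow ((std n ℝ).inducedFigures (infinitesimals n)) X.extFigures f)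
    (hf0 : f ⟨Ext.const (std n ℝ) 0, zero_mem_infinitesimals n⟩ ∈ X.dot U) :
    ∃ hfU : ∀ h : infinitesimals n, f h ∈ X.dot U,
      ∃! ab : (std n F).Ext × F, ∀ h : infinitesimals n,
        Ext.mapOn φ hφ ⟨f h, hfU h⟩ = ab.1 + h.1 • Ext.const (std n F) ab.2 := by
  let φ' : PartialArrow X (std n F) := ⟨U, hU, φ, hφ⟩
  have ha : φ'.HasExtValue (f _) (Ext.mapOn φ hφ ⟨_, hf0⟩) :=
    PartialArrow.hasExtValue_iff_mapOn.2 ⟨hf0, rfl⟩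
  obtain ⟨b, hb⟩ := (isParametrizedAt_of_isArrow hf _).exists_hasExtValue_add_smul_const ha
  choose hfU hφf using fun h => PartialArrow.hasExtValue_iff_mapOn.1 (hb h)
  refine ⟨hfU, ⟨_, b⟩, hφf, fun ab hab => ?_⟩
  obtain ⟨ha', hb'⟩ := Ext.affine_injective fun h hh => (hab ⟨h, hh⟩).symm.trans (hφf ⟨h, hh⟩)
  exact Prod.ext ha' hb'

theorem mainTheorem2 {n : ℕ∞} [Fact (1 ≤ n)] {S : Type*} (X : CnSpace n S) {k : ℕ}
    {U : Set S} (hU : IsOpen[X.topology] U)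
    (φ : U → Euc k) (hφ : (X.sub U).IsArrow (std n (Euc k)) φ)
    (f : infinitesimals n → X.Ext)
    (hf : ExtFigures.IsArrow ((std n ℝ).inducedFigures (infinitesimals n)) X.extFigures f)
    (hf0 : f ⟨Ext.const (std n ℝ) 0, zero_mem_infinitesimals n⟩ ∈ X.dot U) :
    ∃ hfU : ∀ h : infinitesimals n, f h ∈ X.dot U,
      ∃! ab : (std n (Euc k)).Ext × Euc k, ∀ h : infinitesimals n,
        Ext.mapOn φ hφ ⟨f h, hfU h⟩ = ab.1 + h.1 • Ext.const (std n (Euc k)) ab.2 :=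
  mainTheorem2_general X hU φ hφ f hf hf0
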